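/- Let $G=(V,E,m,w)$ be a connected weighted graph: $(V,E)$ is a locally finite, simple, undirected, connected graph, and $w:E\to(0,\infty)$ (symmetric) and $m:V\to(0,\infty)$ are edge and vertex weights. Assume that $G$ has bounded geometry, i.e. there is a constant $C>0$ with $\deg(x)\le C$ and $C^{-1}\le m(x)\le C$ for all $x\in V$, and $C^{-1}\le w(x,y)\le C$ for all $x\sim y$. For $f,g:V\to\mathbb R$ put $$\Delta f(x)=\sum_{y\sim x}\frac{w(x,y)}{m(x)}\,(f(y)-f(x)),\qquad \Gamma(f,g)=\tfrac12\big(\Delta(fg)-f\Delta g-g\Delta f\big),\qquad \Gamma_2(f,g)=\tfrac12\big(\Delta\Gamma(f,g)-\Gamma(f,\Delta g)-\Gamma(g,\Delta f)\big).$$ Let $\mathcal K_\infty(x)\in[-\infty,\infty]$ be the supremum of all $K\in\mathbb R$ such that $\Gamma_2(f,f)(x)\ge K\,\Gamma(f,f)(x)$ for every $f:V\to\mathbb R$. With $d$ the combinatorial graph distance, let $B_R(x_0)=\{y: d(y,x_0)\le R\}$ and $S_R(x_0)=\{y: d(y,x_0)=R\}$. **Theorem 1.2.** Let $x_0\in V$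 and let $R_0\ge 0$ be an integer such that $B_{R_0}(x_0)\ne V$ (which always holds when $V$ is infinite). Suppose that $G$ satisfies $\mathrm{CD}(0,\infty)$ outside $B_{R_0}(x_0)$, i.e. $\mathcal K_\infty(x)\ge 0$ for every $x\in V\setminus B_{R_0}(x_0)$. Then the real vector space $\mathcal H_0(G)$ of bounded functions $u:V\to\mathbb R$ with $\Delta u=0$ on $V$ satisfies $$\dim\mathcal H_0(G)\le \sharp S_{R_0+1}(x_0)<\infty .$$ -/

import Mathlib

noncomputable section

/-- A weighted graph `G = (V, E, m, w)`: a locally finite, simple, undirected graph on `V` with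
a positive symmetric edge weight `w` and a positive vertex weight `m`.
The values of `w` at pairs of vertices that are not adjacent are irrelevant. -/
structure WeightedGraph (V : Type*) where
  graph : SimpleGraph V
  locallyFinite : ∀ x, (graph.neighborSet x).Finite
  w : V → V → ℝ
  w_symm : ∀ x y, graph.Adj x y → w x y = w y x
  w_pos : ∀ x y, graph.Adj x y → 0 < w x y
  m : V → ℝ
  m_pos : ∀ x, 0 < m x

namespace WeightedGraph

variable {V : Type*} (G : WeightedGraph V)

/-- The finite set of neighbours of a vertex. -/
def nbrs (x : V) : Finset V := (G.locallyFinite x).toFinset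

/-- The combinatorial degree of a vertex. -/
def deg (x : V) : ℕ := (G.nbrs x).card

/-- The ball `B_R(x)` for the combinatorial distance. -/
def ball (x : V) (R : ℕ) : Set V := {y | G.graph.dist y x ≤ R}

/-- The sphere `S_R(x)` for the combinatorial distance. -/
def sphere (x : V) (R : ℕ) : Set V := {y | G.graph.dist y x = R}

/-- Bounded geometry: degrees are bounded above, and vertex and edge weights are bounded above
and away from zero. -/
def BoundedGeometry : Prop :=
  ∃ C : ℝ, 0 < C ∧
    (∀ x, (G.deg x : ℝ) ≤ C) ∧
    (∀ x, C⁻¹ ≤ G.m x ∧ G.m x ≤ C) ∧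
    (∀ x y, G.graph.Adj x y → C⁻¹ ≤ G.w x y ∧ G.w x y ≤ C)

/-- The Laplace operator `Δ f (x) = ∑_{y ∼ x} w(x,y) / m(x) * (f(y) - f(x))`. -/
def laplacian (f : V → ℝ) (x : V) : ℝ :=
  ∑ y ∈ G.nbrs x, G.w x y / G.m x * (f y - f x)

/-- The carré du champ `Γ(f,g) = (Δ(fg) - f Δg - g Δf) / 2`. -/
def Gam (f g : V → ℝ) (x : V) : ℝ :=
  (G.laplacian (f * g) x - f x * G.laplacian g x - g x * G.laplacian f x) / 2

/-- The iterated form `Γ₂(f,g) = (Δ Γ(f,g) - Γ(f,Δg) - Γ(g,Δf)) / 2`. -/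
def Gam₂ (f g : V → ℝ) (x : V) : ℝ :=
  (G.laplacian (G.Gam f g) x - G.Gam f (G.laplacian g) x - G.Gam g (G.laplacian f) x) / 2

/-- The curvature dimension condition `CD(K,n)` at the vertex `x`, for `n ∈ (0,∞]`:
`Γ₂(f)(x) ≥ (1/n) (Δf(x))² + K Γ(f)(x)` for all functions `f`, with `1/∞ = 0`. -/
def CD (K : ℝ) (n : ENNReal) (x : V) : Prop :=
  ∀ f : V → ℝ,
    (n⁻¹).toReal * G.laplacian f x ^ 2 + K * G.Gam f f x ≤ G.Gam₂ f f x

/-- The Bakry–Émery curvature at `x`: the largest `K` such that `CD(K,n)` holds at `x`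
(a supremum in the extended reals). -/
def curvature (n : ENNReal) (x : V) : EReal :=
  sSup {k : EReal | ∃ K : ℝ, G.CD K n x ∧ k = (K : EReal)}

/-- `G` satisfies `CD(0,∞)` outside `Ω`: the Bakry–Émery curvature of dimension `∞` is
nonnegative at all vertices outside `Ω`. -/
def CDOutside (Ω : Set V) : Prop := ∀ x, x ∉ Ω → 0 ≤ G.curvature ⊤ x

theorem laplacian_add (f g : V → ℝ) (x : V) :
    G.laplacian (f + g) x = G.laplacian f x + G.laplacian g x := by
  simp only [laplacian, Pi.add_apply, ← Finset.sum_add_distrib]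
  exact Finset.sum_congr rfl fun y _ => by ring

theorem laplacian_smul (c : ℝ) (f : V → ℝ) (x : V) :
    G.laplacian (c • f) x = c * G.laplacian f x := by
  simp only [laplacian, Pi.smul_apply, smul_eq_mul, Finset.mul_sum]
  exact Finset.sum_congr rfl fun y _ => by ring

/-- The real vector space `H₀(G)` of bounded harmonic functions on `V`. -/
def boundedHarmonic : Submodule ℝ (V → ℝ) where
  carrier := {f | (∀ x, G.laplacian f x = 0) ∧ ∃ C : ℝ, ∀ x, |f x| ≤ C}
  zero_mem' := ⟨fun x => by simp [laplacian], 0, fun x => by simp⟩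
  add_mem' := by
    rintro f g ⟨hf, A, hA⟩ ⟨hg, B, hB⟩
    refine ⟨fun x => by rw [laplacian_add, hf, hg, add_zero], A + B, fun x => ?_⟩
    exact (abs_add_le (f x) (g x)).trans (add_le_add (hA x) (hB x))
  smul_mem' := by
    rintro c f ⟨hf, A, hA⟩
    refine ⟨fun x => by rw [laplacian_smul, hf, mul_zero], |c| * A, fun x => ?_⟩
    rw [Pi.smul_apply, smul_eq_mul, abs_mul]
    exact mul_le_mul_of_nonneg_left (hA x) (abs_nonneg c)

end WeightedGraph

end

namespace WeightedGraph

variable {V : Type*} (G : WeightedGraph V)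

/-! Restriction to the sphere `S_{R₀+1}` is injective on bounded harmonic functions. If such an `f`
vanishes on the sphere, the maximum principle kills it on `B_{R₀+1}`, so `Γ(f) = 0` on `B_{R₀}`,
where `ΔΓ(f) ≥ 0` is then automatic. Elsewhere `ΔΓ(f) = 2Γ₂(f) ≥ 0` by curvature. Since `Δ(f²) =
2Γ(f)` with `f²` bounded, `nonpos_of_le_laplacian` forces the subharmonic `Γ(f)` to vanish, so `f`
is constant, hence zero. -/

theorem mem_nbrs {x y : V} : y ∈ G.nbrs x ↔ G.graph.Adj x y := by
  simp [nbrs]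

theorem weight_div_pos {x y : V} (h : y ∈ G.nbrs x) : 0 < G.w x y / G.m x :=
  div_pos (G.w_pos x y (G.mem_nbrs.1 h)) (G.m_pos x)

theorem Gam_self (f : V → ℝ) (x : V) :
    G.Gam f f x = (∑ y ∈ G.nbrs x, G.w x y / G.m x * (f y - f x) ^ 2) / 2 := by
  simp only [Gam, laplacian, Pi.mul_apply, Finset.mul_sum, ← Finset.sum_sub_distrib]
  congr 1
  exact Finset.sum_congr rfl fun y _ => by ring

theorem Gam_self_nonneg (f : V → ℝ) (x : V) : 0 ≤ G.Gam f f x := by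
  rw [Gam_self]
  exact div_nonneg (Finset.sum_nonneg fun y hy =>
    mul_nonneg (G.weight_div_pos hy).le (sq_nonneg _)) two_pos.le

theorem eq_of_Gam_self_eq_zero {f : V → ℝ} {x y : V} (h : G.Gam f f x = 0)
    (hxy : G.graph.Adj x y) : f y = f x := by
  rw [Gam_self, div_eq_zero_iff, or_iff_left two_ne_zero,
    Finset.sum_eq_zero_iff_of_nonneg fun y hy =>
      mul_nonneg (G.weight_div_pos hy).le (sq_nonneg _)] at h
  have hy := G.mem_nbrs.2 hxy
  have := (mul_eq_zero.1 (h y hy)).resolve_left (G.weight_div_pos hy).ne'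
  exact sub_eq_zero.1 (pow_eq_zero_iff two_ne_zero |>.1 this)

theorem Gam_self_eq_zero {f : V → ℝ} {x : V} (h : ∀ y, G.graph.Adj x y → f y = f x) :
    G.Gam f f x = 0 := by
  rw [Gam_self, Finset.sum_eq_zero, zero_div]
  intro y hy
  rw [h y (G.mem_nbrs.1 hy)]
  ring

theorem laplacian_mul_self {f : V → ℝ} {x : V} (hf : G.laplacian f x = 0) :
    G.laplacian (f * f) x = 2 * G.Gam f f x := by
  simp only [Gam, hf]
  ring

/-- The total weight `∑_{y ∼ x} w(x,y) / m(x)` is bounded on graphs of bounded geometry. -/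
theorem BoundedGeometry.exists_sum_weight_le {G : WeightedGraph V} (hG : G.BoundedGeometry) :
    ∃ D : ℝ, 0 < D ∧ ∀ x, ∑ y ∈ G.nbrs x, G.w x y / G.m x ≤ D := by
  obtain ⟨C, hC, hdeg, hm, hw⟩ := hG
  refine ⟨C * (C * C), by positivity, fun x => ?_⟩
  have hle : ∀ y ∈ G.nbrs x, G.w x y / G.m x ≤ C * C := fun y hy => by
    rw [div_eq_mul_inv]
    exact mul_le_mul (hw x y (G.mem_nbrs.1 hy)).2 (inv_le_of_inv_le₀ hC (hm x).1)
      (inv_nonneg.2 (G.m_pos x).le) hC.le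
  refine (Finset.sum_le_card_nsmul _ _ _ hle).trans ?_
  rw [nsmul_eq_mul]
  exact mul_le_mul_of_nonneg_right (hdeg x) (by positivity)

/-- If the total weight is at most `D`, then `f ↦ D f + Δf` is monotone. -/
theorem add_laplacian_mono {D : ℝ} {x : V}
    (hx : ∑ y ∈ G.nbrs x, G.w x y / G.m x ≤ D) {f g : V → ℝ} (hfg : ∀ y, f y ≤ g y) :
    D * f x + G.laplacian f x ≤ D * g x + G.laplacian g x := by
  have key : ∀ h : V → ℝ, D * h x + G.laplacian h x =
      (D - ∑ y ∈ G.nbrs x, G.w x y / G.m x) * h x + ∑ y ∈ G.nbrs x, G.w x y / G.m x * h y := by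
    intro h
    simp only [laplacian, mul_sub, Finset.sum_sub_distrib, sub_mul, Finset.sum_mul]
    ring
  rw [key, key]
  exact add_le_add (mul_le_mul_of_nonneg_left (hfg x) (sub_nonneg.2 hx))
    (Finset.sum_le_sum fun y hy =>
      mul_le_mul_of_nonneg_left (hfg y) (G.weight_div_pos hy).le)

theorem laplacian_const_sub (c : ℝ) (f : V → ℝ) (x : V) :
    G.laplacian (fun y => c - f y) x = -G.laplacian f x := by
  simp only [laplacian, ← Finset.sum_neg_distrib]
  exact Finset.sum_congr rfl fun y _ => by ring

/-- On a graph of bounded geometry, a subharmonic function `g` with `g ≤ Δf` for a bounded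
function `f` is nonpositive. -/
theorem BoundedGeometry.nonpos_of_le_laplacian {G : WeightedGraph V} (hG : G.BoundedGeometry)
    {f g : V → ℝ} {M : ℝ} (hf : ∀ x, |f x| ≤ M) (hfg : ∀ x, g x ≤ G.laplacian f x)
    (hg : ∀ x, 0 ≤ G.laplacian g x) (x : V) : g x ≤ 0 := by
  obtain ⟨D, hD, hsum⟩ := hG.exists_sum_weight_le
  have key : ∀ (n : ℕ) (x : V), ((n : ℝ) • g) x ≤ D * M - D * f x := by
    intro n
    induction n with
    | zero =>
      intro x
      have := mul_le_mul_of_nonneg_left (le_of_abs_le (hf x)) hD.le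
      simpa using this
    | succ n ih =>
      intro x
      -- Applying `D + Δ` to the inductive bound adds `-D Δf ≤ -D g` on the right, which supplies
      -- the next copy of `g`.
      have h := G.add_laplacian_mono (hsum x) ih
      have h₁ : G.laplacian (fun y => D * M - D * f y) x = -(D * G.laplacian f x) := by
        rw [laplacian_const_sub, ← laplacian_smul]; rfl
      rw [laplacian_smul, h₁] at h
      have h₂ : 0 ≤ (n : ℝ) * G.laplacian g x := mul_nonneg n.cast_nonneg (hg x)
      simp only [Pi.smul_apply, smul_eq_mul] at h ⊢
      have h₃ := mul_le_mul_of_nonneg_left (hfg x) hD.le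
      refine le_of_mul_le_mul_left ?_ hD
      push_cast
      linarith
  by_contra! hpos
  obtain ⟨n, hn⟩ := exists_nat_gt ((D * M - D * f x) / g x)
  rw [div_lt_iff₀ hpos] at hn
  exact absurd (key n x) (not_le.2 hn)

theorem Gam₂_self_nonneg_of_curvature_nonneg {x : V} (hx : 0 ≤ G.curvature ⊤ x) (f : V → ℝ) :
    0 ≤ G.Gam₂ f f x := by
  have key : ∀ K : ℝ, K < 0 → K * G.Gam f f x ≤ G.Gam₂ f f x := by
    intro K hK
    have hlt : (K : EReal) < G.curvature ⊤ x := (EReal.coe_neg'.2 hK).trans_le hx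
    obtain ⟨_, ⟨K', hCD, rfl⟩, hKK'⟩ := lt_sSup_iff.1 hlt
    have h := hCD f
    simp only [ENNReal.inv_top, ENNReal.toReal_zero, zero_mul, zero_add] at h
    exact (mul_le_mul_of_nonneg_right (EReal.coe_lt_coe_iff.1 hKK').le
      (G.Gam_self_nonneg f x)).trans h
  by_contra! hneg
  have hΓ := G.Gam_self_nonneg f x
  -- The supremum only gives constants `K < 0`. This `K` is negative and makes `K Γ > Γ₂`; the `+ 1`
  -- also covers `Γ = 0`.
  have h := key (G.Gam₂ f f x / (G.Gam f f x + 1)) (div_neg_of_neg_of_pos hneg (by positivity))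
  rw [div_mul_eq_mul_div, div_le_iff₀ (by positivity)] at h
  linarith

theorem Gam₂_self_of_harmonic {f : V → ℝ} (hf : ∀ x, G.laplacian f x = 0) (x : V) :
    G.Gam₂ f f x = G.laplacian (G.Gam f f) x / 2 := by
  have h0 : G.Gam f (G.laplacian f) x = 0 := by
    rw [show G.laplacian f = 0 from funext hf, Gam, hf x]
    simp [laplacian]
  rw [Gam₂, h0, sub_zero, sub_zero]

theorem ball_finite (hconn : G.graph.Connected) (x : V) (R : ℕ) : (G.ball x R).Finite := by
  induction R with
  | zero =>
    refine (Set.finite_singleton x).subset fun y hy => ?_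
    exact hconn.dist_eq_zero_iff.1 (Nat.le_zero.1 hy)
  | succ R ih =>
    refine (ih.union (ih.biUnion fun z _ => G.locallyFinite z)).subset fun y hy => ?_
    obtain ⟨p, hp⟩ := hconn.exists_walk_length_eq_dist y x
    cases p with
    | nil => exact Or.inl (by simp [ball])
    | cons h q =>
      refine Or.inr (Set.mem_biUnion (x := _) ?_ h.symm)
      have hy' : G.graph.dist y x ≤ R + 1 := hy
      rw [SimpleGraph.Walk.length_cons] at hp
      exact (SimpleGraph.dist_le q).trans (by omega)

theorem mem_ball_succ_of_adj (hconn : G.graph.Connected) {x₀ y z : V} {R : ℕ}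
    (hy : y ∈ G.ball x₀ R) (h : G.graph.Adj y z) : z ∈ G.ball x₀ (R + 1) := by
  have h₁ := hconn.dist_triangle (u := z) (v := y) (w := x₀)
  have h₂ := SimpleGraph.dist_eq_one_iff_adj.2 h.symm
  have h₃ : G.graph.dist y x₀ ≤ R := hy
  change G.graph.dist z x₀ ≤ R + 1
  omega

theorem mem_sphere_succ {x₀ z : V} {R : ℕ} (hz : z ∈ G.ball x₀ (R + 1))
    (hz' : z ∉ G.ball x₀ R) : z ∈ G.sphere x₀ (R + 1) := by
  simp only [ball, sphere, Set.mem_ofPred_eq] at *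
  omega

/-- At an interior maximum of a harmonic function, the neighbours attain the maximum too. -/
theorem eq_of_laplacian_eq_zero_of_forall_le {f : V → ℝ} {x : V} (hf : G.laplacian f x = 0)
    (hmax : ∀ y, G.graph.Adj x y → f y ≤ f x) {y : V} (hxy : G.graph.Adj x y) : f y = f x := by
  have hterm : ∀ y ∈ G.nbrs x, G.w x y / G.m x * (f y - f x) ≤ 0 := fun y hy =>
    mul_nonpos_of_nonneg_of_nonpos (G.weight_div_pos hy).le
      (sub_nonpos.2 (hmax y (G.mem_nbrs.1 hy)))
  have hy := G.mem_nbrs.2 hxy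
  have h := (Finset.sum_eq_zero_iff_of_nonpos hterm).1 hf y hy
  exact sub_eq_zero.1 ((mul_eq_zero.1 h).resolve_left (G.weight_div_pos hy).ne')

/-- Maximum principle: a function harmonic on a ball `B_R ≠ V` and nonpositive on the sphere
`S_{R+1}` is nonpositive on `B_{R+1}`. -/
theorem nonpos_on_ball_of_nonpos_on_sphere (hconn : G.graph.Connected) {x₀ : V} {R : ℕ}
    (hproper : G.ball x₀ R ≠ Set.univ) {f : V → ℝ}
    (hf : ∀ x ∈ G.ball x₀ R, G.laplacian f x = 0)
    (hs : ∀ x ∈ G.sphere x₀ (R + 1), f x ≤ 0) {x : V} (hx : x ∈ G.ball x₀ (R + 1)) :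
    f x ≤ 0 := by
  obtain ⟨y, hy, hmax⟩ :=
    Set.exists_max_image _ f (G.ball_finite hconn x₀ (R + 1)) ⟨x, hx⟩
  refine (hmax x hx).trans ?_
  obtain ⟨v, hv⟩ := (Set.ne_univ_iff_exists_notMem _).1 hproper
  -- The maximum propagates along a walk towards `v ∉ B_R` until the walk first leaves `B_R`,
  -- necessarily at a point of `S_{R+1}`.
  have key : ∀ a : V, G.graph.Walk a v → a ∈ G.ball x₀ (R + 1) → f a = f y → f y ≤ 0 := by
    intro a p
    induction p with
    | nil => exact fun ha hay => hay ▸ hs _ (G.mem_sphere_succ ha hv)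
    | @cons a b _ h _ ih =>
      intro ha hay
      by_cases haR : a ∈ G.ball x₀ R
      · refine ih hv (G.mem_ball_succ_of_adj hconn haR h) ?_
        rw [← hay]
        refine G.eq_of_laplacian_eq_zero_of_forall_le (hf a haR) (fun c hc => ?_) h
        rw [hay]
        exact hmax c (G.mem_ball_succ_of_adj hconn haR hc)
      · exact hay ▸ hs a (G.mem_sphere_succ ha haR)
  exact key y (hconn.preconnected y v).some hy rfl

theorem eq_zero_on_ball_of_eq_zero_on_sphere (hconn : G.graph.Connected) {x₀ : V} {R : ℕ}
    (hproper : G.ball x₀ R ≠ Set.univ) {f : V → ℝ}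
    (hf : ∀ x ∈ G.ball x₀ R, G.laplacian f x = 0)
    (hs : ∀ x ∈ G.sphere x₀ (R + 1), f x = 0) {x : V} (hx : x ∈ G.ball x₀ (R + 1)) :
    f x = 0 := by
  refine le_antisymm
    (G.nonpos_on_ball_of_nonpos_on_sphere hconn hproper hf (fun x hx => (hs x hx).le) hx) ?_
  have h := G.nonpos_on_ball_of_nonpos_on_sphere hconn hproper (f := (-1 : ℝ) • f)
    (fun x hx => by rw [laplacian_smul, hf x hx, mul_zero])
    (fun x hx => by simp [hs x hx]) hx
  simpa using h

/-- If `CD(0,∞)` holds outside `B_R ≠ V`, a bounded harmonic function vanishing on `S_{R+1}`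
vanishes identically: `Γ(f)` is then subharmonic on all of `V`. -/
theorem eq_zero_of_eq_zero_on_sphere (hconn : G.graph.Connected) (hG : G.BoundedGeometry)
    {x₀ : V} {R : ℕ} (hproper : G.ball x₀ R ≠ Set.univ) (hCD : G.CDOutside (G.ball x₀ R))
    {f : V → ℝ} (hf : f ∈ G.boundedHarmonic) (hs : ∀ x ∈ G.sphere x₀ (R + 1), f x = 0) :
    f = 0 := by
  obtain ⟨hharm, M, hM⟩ := hf
  have hball : ∀ x ∈ G.ball x₀ (R + 1), f x = 0 := fun x =>
    G.eq_zero_on_ball_of_eq_zero_on_sphere hconn hproper (fun x _ => hharm x) hs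
  have hsub : ∀ x, 0 ≤ G.laplacian (G.Gam f f) x := by
    intro x
    by_cases hx : x ∈ G.ball x₀ R
    -- No curvature is needed here: `Γ(f)` attains its minimum value `0` at `x`, as all neighbours
    -- of `x` lie in `B_{R+1}`.
    · have h0 : G.Gam f f x = 0 := G.Gam_self_eq_zero fun y hy => by
        rw [hball y (G.mem_ball_succ_of_adj hconn hx hy), hball x (Nat.le_succ_of_le hx)]
      refine Finset.sum_nonneg fun y hy => mul_nonneg (G.weight_div_pos hy).le ?_
      rw [h0, sub_zero]
      exact G.Gam_self_nonneg f y
    · have h := G.Gam₂_self_nonneg_of_curvature_nonneg (hCD x hx) f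
      rw [G.Gam₂_self_of_harmonic hharm] at h
      linarith
  have hΓ : ∀ x, G.Gam f f x = 0 := fun x =>
    le_antisymm (hG.nonpos_of_le_laplacian (f := f * f) (M := M * M)
      (fun y => by
        rw [Pi.mul_apply, abs_mul]
        exact mul_self_le_mul_self (abs_nonneg _) (hM y))
      (fun y => by
        rw [G.laplacian_mul_self (hharm y)]
        linarith [G.Gam_self_nonneg f y])
      hsub x) (G.Gam_self_nonneg f x)
  have hconst : ∀ x y : V, G.graph.Walk x y → f x = f y := by
    intro x y p
    induction p with
    | nil => rfl
    | cons h _ ih => exact (G.eq_of_Gam_self_eq_zero (hΓ _) h).symm.trans ih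
  funext x
  rw [hconst x x₀ (hconn.preconnected x x₀).some]
  exact hball x₀ (by simp [ball])

end WeightedGraph

theorem theorem1p2 {V : Type*} (G : WeightedGraph V) (hconn : G.graph.Connected)
    (hG : G.BoundedGeometry) (x₀ : V) (R₀ : ℕ)
    (hproper : G.ball x₀ R₀ ≠ Set.univ)
    (hCD : G.CDOutside (G.ball x₀ R₀)) :
    Module.rank ℝ G.boundedHarmonic ≤ Cardinal.mk (G.sphere x₀ (R₀ + 1)) ∧
      (G.sphere x₀ (R₀ + 1)).Finite := by
  have hfin : (G.sphere x₀ (R₀ + 1)).Finite :=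
    (G.ball_finite hconn x₀ (R₀ + 1)).subset fun _ hy => le_of_eq hy
  refine ⟨?_, hfin⟩
  have := hfin.fintype
  let φ : G.boundedHarmonic →ₗ[ℝ] (G.sphere x₀ (R₀ + 1) → ℝ) :=
    LinearMap.funLeft ℝ ℝ Subtype.val ∘ₗ G.boundedHarmonic.subtype
  have hφ : Function.Injective φ := by
    rw [injective_iff_map_eq_zero]
    intro f hf
    exact Subtype.ext (G.eq_zero_of_eq_zero_on_sphere hconn hG hproper hCD f.2
      fun x hx => congrFun hf ⟨x, hx⟩)
  refine (LinearMap.rank_le_of_injective φ hφ).trans_eq ?_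
  rw [rank_fun', Cardinal.mk_fintype]
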